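/- Let $\mathbb K$ be a field of characteristic zero and $A$ a vector space over $\mathbb K$ (not necessarily finite-dimensional) with two bilinear operations $\cdot,\circ$ and linear maps $P,Q:A\to A$. Write $[x,y]=x\circ y-y\circ x$, $\mathcal L_\cdot(x)y=x\cdot y$, $\mathcal L_\circ(x)y=x\circ y$, $\mathcal R_\circ(x)y=y\circ x$, $\mathrm{ad}(x)y=[x,y]$, $\tau(x\otimes y)=y\otimes x$, $\xi(x\otimes y\otimes z)=y\otimes z\otimes x$. **Algebras.** $(A,\circ)$ is an *anti-pre-Lie algebra* if $x\circ(y\circ z)-y\circ(x\circ z)=[y,x]\circ z$ and $[x,y]\circ z+[y,z]\circ x+[z,x]\circ y=0$. $(A,\cdot,\circ,P,Q)$ is a *relative PCA algebra* if $(A,\cdot)$ is commutative and associative, $(A,\circ)$ is anti-pre-Lie, $(A,[-,-])$ is a Lie algebra, $P$ is a derivation of both $\cdot$ and $[-,-]$, $[z,x\cdot y]=[z,x]\cdot y+x\cdot[z,y]+x\cdot y\cdot P(z)$, and for all $x,y,z\in A$ $$x\cdot Q(y)-P(x)\cdot y-Q(x\cdot y)=0,\qquad x\circ Q(y)-P(x)\circ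 y-Q(x\circ y)=0,$$ $$x\cdot(y\circ z)-y\circ(x\cdot z)+[x,y]\cdot z-x\cdot P(y)\cdot z=0,\qquad (x\cdot y)\circ z-y\circ(x\cdot z)-x\circ(y\cdot z)+Q(x\cdot y\cdot z)=0.$$ **Coalgebras.** Let $\Delta,\theta:A\to A\otimes A$ be linear and $\delta=\theta-\tau\theta$. $(A,\Delta)$ is a *cocommutative coassociative coalgebra* if $\tau\Delta=\Delta$ and $(\mathrm{id}\otimes\Delta)\Delta=(\Delta\otimes\mathrm{id})\Delta$. $(A,\theta)$ is an *anti-pre-Lie coalgebra* if $(\mathrm{id}^{\otimes3}-\tau\otimes\mathrm{id})(\mathrm{id}\otimes\theta)\theta=(\tau\otimes\mathrm{id}-\mathrm{id}^{\otimes3})(\theta\otimes\mathrm{id})\theta$ and $(\mathrm{id}^{\otimes3}+\xi+\xi^2)(\tau\otimes\mathrm{id}-\mathrm{id}^{\otimes3})(\theta\otimes\mathrm{id})\theta=0$. $(A,\Delta,\theta,Q,P)$ is a *relative PCA coalgebra* if both hold and $$\Delta Q=(Q\otimes\mathrm{id}+\mathrm{id}\otimes Q)\Delta,\qquad \delta Q=(Q\otimes\mathrm{id}+\mathrm{id}\otimes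 Q)\delta,$$ $$(\mathrm{id}\otimes\Delta)\delta-(\delta\otimes\mathrm{id})\Delta-(\tau\otimes\mathrm{id})(\mathrm{id}\otimes\delta)\Delta-(Q\otimes\mathrm{id}\otimes\mathrm{id})(\Delta\otimes\mathrm{id})\Delta=0,$$ $$\Delta P=(\mathrm{id}\otimes P-Q\otimes\mathrm{id})\Delta,\qquad \theta P=(\mathrm{id}\otimes P-Q\otimes\mathrm{id})\theta,$$ $$(\mathrm{id}\otimes\theta)\Delta-(\tau\otimes\mathrm{id})(\mathrm{id}\otimes\Delta)\theta+(\delta\otimes\mathrm{id})\Delta-(\mathrm{id}\otimes Q\otimes\mathrm{id})(\Delta\otimes\mathrm{id})\Delta=0,$$ $$(\Delta\otimes\mathrm{id})\theta=(\tau\otimes\mathrm{id})(\mathrm{id}\otimes\Delta)\theta+(\mathrm{id}\otimes\Delta)\theta-(\Delta\otimes\mathrm{id})\Delta P.$$ **Bialgebras.** $(A,\cdot,\circ,\Delta,\theta,P,Q)$ is a *relative PCA bialgebra* if $(A,\cdot,\circ,P,Q)$ is a relative PCA algebra, $(A,\Delta,\theta,Q,P)$ is a relative PCA coalgebra, and for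 all $x,y\in A$: the commutative and cocommutative antisymmetric infinitesimal bialgebra condition $$\Delta(x\cdot y)=(\mathcal L_\cdot(x)\otimes\mathrm{id})\Delta(y)+(\mathrm{id}\otimes\mathcal L_\cdot(y))\Delta(x),$$ the anti-pre-Lie bialgebra conditions $$(\mathrm{id}^{\otimes2}-\tau)\big(\theta(x\circ y)-(\mathcal L_\circ(x)\otimes\mathrm{id})\theta(y)-(\mathrm{id}\otimes\mathcal L_\circ(x))\theta(y)+(\mathrm{id}\otimes\mathcal R_\circ(y))\theta(x)\big)=0,$$ $$\theta([x,y])=(\mathrm{id}\otimes\mathrm{ad}(x)-\mathcal L_\circ(x)\otimes\mathrm{id})\theta(y)-(\mathrm{id}\otimes\mathrm{ad}(y)-\mathcal L_\circ(y)\otimes\mathrm{id})\theta(x),$$ and the four mixed conditions $$\theta(x\cdot y)+(\mathcal L_\circ(y)\otimes\mathrm{id})\Delta(x)-(\mathrm{id}\otimes\mathcal L_\cdot(x))\theta(y)+(\mathcal L_\circ(x)\otimes\mathrm{id})\Delta(y)-(\mathrm{id}\otimes\mathcal L_\cdot(y))\theta(x)-(Q\otimes\mathrm{id})\Delta(x\cdot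 y)=0,$$ $$\Delta(x\circ y)+(\tau+\mathrm{id}^{\otimes2})(\mathrm{id}\otimes\mathcal L_\cdot(y))\theta(x)-(\mathrm{id}\otimes\mathcal L_\circ(x)+\mathcal L_\circ(x)\otimes\mathrm{id})\Delta(y)-\Delta(P(x)\cdot y)=0,$$ $$(\mathcal L_\cdot(x)\otimes\mathrm{id}-\mathrm{id}\otimes\mathcal L_\cdot(x))\theta(y)+(\mathcal L_\circ(y)\otimes\mathrm{id}-\mathrm{id}\otimes\mathrm{ad}(y))\Delta(x)-\Delta([x,y])+\Delta(x\cdot P(y))=0,$$ $$(\mathrm{id}\otimes\mathcal R_\circ(y))\Delta(x)+(\mathcal L_\cdot(x)\otimes\mathrm{id})\delta(y)-(\mathrm{id}\otimes\mathcal L_\circ(x))\Delta(y)+\tau(\mathrm{id}\otimes\mathcal L_\cdot(y))\theta(x)-\delta(x\cdot y)+(\mathrm{id}\otimes Q)\Delta(x\cdot y)=0.$$ For $r\in A\otimes A$ put $$\Delta_r(x)=(\mathrm{id}\otimes\mathcal L_\cdot(x)-\mathcal L_\cdot(x)\otimes\mathrm{id})r,\qquad \theta_r(x)=(\mathcal L_\circ(x)\otimes\mathrm{id}-\mathrm{id}\otimes\mathrm{ad}(x))r.$$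 A relative PCA bialgebra is *coboundary* if $\Delta=\Delta_r$ and $\theta=\theta_r$ for some $r\in A\otimes A$. **Yang–Baxter equation.** For $r=\sum_i a_i\otimes b_i$ let $$\mathbf A(r)=\sum_{i,j}\big(a_i\cdot a_j\otimes b_i\otimes b_j-a_i\otimes a_j\cdot b_i\otimes b_j+a_i\otimes a_j\otimes b_i\cdot b_j\big),$$ $$\mathbf T(r)=\sum_{i,j}\big(a_i\circ a_j\otimes b_i\otimes b_j+a_i\otimes b_i\circ a_j\otimes b_j-a_i\otimes a_j\otimes[b_i,b_j]\big).$$ In a relative PCA algebra $(A,\cdot,\circ,P,Q)$, $r$ is a *solution of the relative PCA Yang–Baxter equation* if $\mathbf A(r)=\mathbf T(r)=0$, $(Q\otimes\mathrm{id}-\mathrm{id}\otimes P)r=0$ and $(P\otimes\mathrm{id}-\mathrm{id}\otimes Q)r=0$. **Statement.** Let $(A,\cdot,\circ,P,Q)$ be a relative PCA algebra and let $r\in A\otimes A$ be an antisymmetric ($r=-\tau(r)$) solution of the relative PCA Yang–Baxter equation in it. Then $(A,\cdot,\circ,\Delta_r,\theta_r,P,Q)$ is a coboundary relative PCA bialgebra.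 -/

import Mathlib

open scoped TensorProduct

namespace RelPCA

variable {K A : Type*} [Field K] [AddCommGroup A] [Module K A]

/-! ## Algebras. A binary operation on `A` is a bilinear map `A →ₗ[K] A →ₗ[K] A`. -/

/-- `(A, m)` is a commutative associative algebra (not necessarily unital). -/
structure IsCommAssoc (m : A →ₗ[K] A →ₗ[K] A) : Prop where
  comm : ∀ x y, m x y = m y x
  assoc : ∀ x y z, m (m x y) z = m x (m y z)

/-- `(A, b)` is a Lie algebra. -/
structure IsLieBracket (b : A →ₗ[K] A →ₗ[K] A) : Prop where
  alternating : ∀ x, b x x = 0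
  jacobi : ∀ x y z, b x (b y z) + b y (b z x) + b z (b x y) = 0

/-- `P` is a derivation of `(A, m)`. -/
def IsDerivation (m : A →ₗ[K] A →ₗ[K] A) (P : A →ₗ[K] A) : Prop :=
  ∀ x y, P (m x y) = m (P x) y + m x (P y)

/-- `(A, m, b, P)` is a relative Poisson algebra. -/
structure IsRelPoisson (m b : A →ₗ[K] A →ₗ[K] A) (P : A →ₗ[K] A) : Prop where
  commAssoc : IsCommAssoc m
  lie : IsLieBracket b
  deriv_mul : IsDerivation m P
  deriv_bracket : IsDerivation b P
  leibniz : ∀ x y z, b z (m x y) = m (b z x) y + m x (b z y) + m (m x y) (P z)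

/-- The commutator `[x, y] = x ∘ y - y ∘ x`. -/
def bracket (c : A →ₗ[K] A →ₗ[K] A) : A →ₗ[K] A →ₗ[K] A := c - c.flip

@[simp] theorem bracket_apply (c : A →ₗ[K] A →ₗ[K] A) (x y : A) :
    bracket c x y = c x y - c y x := rfl

/-- `(A, c)` is an anti-pre-Lie algebra. -/
structure IsAntiPreLie (c : A →ₗ[K] A →ₗ[K] A) : Prop where
  left_comm : ∀ x y z, c x (c y z) - c y (c x z) = c (bracket c y x) z
  cyclic : ∀ x y z,
    c (bracket c x y) z + c (bracket c y z) x + c (bracket c z x) y = 0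

/-- `(A, m, c, P, Q)` is a relative PCA algebra. -/
structure IsRelPCAAlgebra (m c : A →ₗ[K] A →ₗ[K] A) (P Q : A →ₗ[K] A) : Prop where
  commAssoc : IsCommAssoc m
  antiPreLie : IsAntiPreLie c
  relPoisson : IsRelPoisson m (bracket c) P
  mul_Q : ∀ x y, m x (Q y) - m (P x) y - Q (m x y) = 0
  circ_Q : ∀ x y, c x (Q y) - c (P x) y - Q (c x y) = 0
  mul_circ : ∀ x y z,
    m x (c y z) - c y (m x z) + m (bracket c x y) z - m (m x (P y)) z = 0
  circ_mul : ∀ x y z,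
    c (m x y) z - c y (m x z) - c x (m y z) + Q (m (m x y) z) = 0

/-! ## Tensor powers. The triple tensor power is taken to be `A ⊗ (A ⊗ A)`. -/

/-- The flip `τ (x ⊗ y) = y ⊗ x`. -/
noncomputable def tau : A ⊗[K] A →ₗ[K] A ⊗[K] A :=
  (TensorProduct.comm K A A).toLinearMap

/-- `τ ⊗ id : x ⊗ y ⊗ z ↦ y ⊗ x ⊗ z`. -/
noncomputable def tauId : A ⊗[K] (A ⊗[K] A) →ₗ[K] A ⊗[K] (A ⊗[K] A) :=
  (TensorProduct.leftComm K A A A).toLinearMap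

/-- `ξ : x ⊗ y ⊗ z ↦ y ⊗ z ⊗ x`. -/
noncomputable def xi : A ⊗[K] (A ⊗[K] A) →ₗ[K] A ⊗[K] (A ⊗[K] A) :=
  (TensorProduct.assoc K A A A).toLinearMap ∘ₗ (TensorProduct.comm K A (A ⊗[K] A)).toLinearMap

/-- `id ⊗ D : A ⊗ A → A ⊗ A ⊗ A` for `D : A → A ⊗ A`. -/
noncomputable def idTensor (D : A →ₗ[K] A ⊗[K] A) : A ⊗[K] A →ₗ[K] A ⊗[K] (A ⊗[K] A) :=
  LinearMap.lTensor A D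

/-- `D ⊗ id : A ⊗ A → A ⊗ A ⊗ A` for `D : A → A ⊗ A`. -/
noncomputable def tensorId (D : A →ₗ[K] A ⊗[K] A) : A ⊗[K] A →ₗ[K] A ⊗[K] (A ⊗[K] A) :=
  (TensorProduct.assoc K A A A).toLinearMap ∘ₗ LinearMap.rTensor A D

/-- `f ⊗ id : A ⊗ A → A ⊗ A` for `f : A → A`. -/
noncomputable def onFst (f : A →ₗ[K] A) : A ⊗[K] A →ₗ[K] A ⊗[K] A := LinearMap.rTensor A f

/-- `id ⊗ f : A ⊗ A → A ⊗ A` for `f : A → A`. -/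
noncomputable def onSnd (f : A →ₗ[K] A) : A ⊗[K] A →ₗ[K] A ⊗[K] A := LinearMap.lTensor A f

@[simp] theorem tau_tmul (x y : A) : tau (x ⊗ₜ[K] y) = y ⊗ₜ x := rfl

@[simp] theorem tauId_tmul (x y z : A) :
    tauId (x ⊗ₜ[K] (y ⊗ₜ[K] z)) = y ⊗ₜ (x ⊗ₜ z) := rfl

@[simp] theorem xi_tmul (x y z : A) : xi (x ⊗ₜ[K] (y ⊗ₜ[K] z)) = y ⊗ₜ (z ⊗ₜ x) := rfl

@[simp] theorem idTensor_tmul (D : A →ₗ[K] A ⊗[K] A) (x y : A) :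
    idTensor D (x ⊗ₜ y) = x ⊗ₜ D y := rfl

@[simp] theorem tensorId_tmul (D : A →ₗ[K] A ⊗[K] A) (x y : A) :
    tensorId D (x ⊗ₜ y) = TensorProduct.assoc K A A A (D x ⊗ₜ y) := rfl

@[simp] theorem onFst_tmul (f : A →ₗ[K] A) (x y : A) : onFst f (x ⊗ₜ[K] y) = f x ⊗ₜ y := rfl

@[simp] theorem onSnd_tmul (f : A →ₗ[K] A) (x y : A) : onSnd f (x ⊗ₜ[K] y) = x ⊗ₜ f y := rfl

/-! ## Coalgebras -/

/-- `(A, D)` is a cocommutative coassociative coalgebra (not necessarily counital). -/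
structure IsCocommCoassoc (D : A →ₗ[K] A ⊗[K] A) : Prop where
  cocomm : ∀ x, tau (D x) = D x
  coassoc : ∀ x, idTensor D (D x) = tensorId D (D x)

/-- `(A, θ)` is an anti-pre-Lie coalgebra. -/
structure IsAntiPreLieCoalgebra (θ : A →ₗ[K] A ⊗[K] A) : Prop where
  left_comm : ∀ x,
    idTensor θ (θ x) - tauId (idTensor θ (θ x)) = tauId (tensorId θ (θ x)) - tensorId θ (θ x)
  cyclic : ∀ x,
    (LinearMap.id + xi + xi ∘ₗ xi : A ⊗[K] (A ⊗[K] A) →ₗ[K] A ⊗[K] (A ⊗[K] A))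
      (tauId (tensorId θ (θ x)) - tensorId θ (θ x)) = 0

/-- The cobracket `δ = θ - τ θ`. -/
noncomputable def cobracket (θ : A →ₗ[K] A ⊗[K] A) : A →ₗ[K] A ⊗[K] A := θ - tau ∘ₗ θ

@[simp] theorem cobracket_apply (θ : A →ₗ[K] A ⊗[K] A) (x : A) :
    cobracket θ x = θ x - tau (θ x) := rfl

/-- `(A, D, θ, Q, P)` is a relative PCA coalgebra. -/
structure IsRelPCACoalgebra (D θ : A →ₗ[K] A ⊗[K] A) (Q P : A →ₗ[K] A) : Prop where
  cocommCoassoc : IsCocommCoassoc D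
  antiPreLieCoalgebra : IsAntiPreLieCoalgebra θ
  D_Q : ∀ x, D (Q x) = onFst Q (D x) + onSnd Q (D x)
  cobracket_Q : ∀ x,
    cobracket θ (Q x) = onFst Q (cobracket θ x) + onSnd Q (cobracket θ x)
  coleibniz : ∀ x,
    idTensor D (cobracket θ x) - tensorId (cobracket θ) (D x)
      - tauId (idTensor (cobracket θ) (D x))
      - LinearMap.rTensor (A ⊗[K] A) Q (tensorId D (D x)) = 0
  D_P : ∀ x, D (P x) = onSnd P (D x) - onFst Q (D x)
  θ_P : ∀ x, θ (P x) = onSnd P (θ x) - onFst Q (θ x)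
  D_θ : ∀ x,
    idTensor θ (D x) - tauId (idTensor D (θ x)) + tensorId (cobracket θ) (D x)
      - LinearMap.lTensor A (LinearMap.rTensor A Q) (tensorId D (D x)) = 0
  θ_D : ∀ x,
    tensorId D (θ x) = tauId (idTensor D (θ x)) + idTensor D (θ x) - tensorId D (D (P x))

/-! ## Bialgebras. Left multiplication is `m x`, right multiplication is `m.flip x`. -/

/-- `(A, m, D)` is a commutative and cocommutative antisymmetric infinitesimal bialgebra. -/
structure IsASIBialgebra (m : A →ₗ[K] A →ₗ[K] A) (D : A →ₗ[K] A ⊗[K] A) : Prop where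
  commAssoc : IsCommAssoc m
  cocommCoassoc : IsCocommCoassoc D
  compat : ∀ x y, D (m x y) = onFst (m x) (D y) + onSnd (m y) (D x)

/-- `(A, c, θ)` is an anti-pre-Lie bialgebra. -/
structure IsAntiPreLieBialgebra (c : A →ₗ[K] A →ₗ[K] A) (θ : A →ₗ[K] A ⊗[K] A) : Prop where
  antiPreLie : IsAntiPreLie c
  antiPreLieCoalgebra : IsAntiPreLieCoalgebra θ
  compat₁ : ∀ x y,
    (LinearMap.id - tau : A ⊗[K] A →ₗ[K] A ⊗[K] A)
      (θ (c x y) - onFst (c x) (θ y) - onSnd (c x) (θ y) + onSnd (c.flip y) (θ x)) = 0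
  compat₂ : ∀ x y,
    θ (bracket c x y) = (onSnd (bracket c x) (θ y) - onFst (c x) (θ y))
      - (onSnd (bracket c y) (θ x) - onFst (c y) (θ x))

/-- `(A, m, c, D, θ, P, Q)` is a relative PCA bialgebra. -/
structure IsRelPCABialgebra (m c : A →ₗ[K] A →ₗ[K] A) (D θ : A →ₗ[K] A ⊗[K] A)
    (P Q : A →ₗ[K] A) : Prop where
  algebra : IsRelPCAAlgebra m c P Q
  coalgebra : IsRelPCACoalgebra D θ Q P
  asi : IsASIBialgebra m D
  antiPreLieBialgebra : IsAntiPreLieBialgebra c θ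
  compat₁ : ∀ x y,
    θ (m x y) + onFst (c y) (D x) - onSnd (m x) (θ y)
      + onFst (c x) (D y) - onSnd (m y) (θ x) - onFst Q (D (m x y)) = 0
  compat₂ : ∀ x y,
    D (c x y) + (tau (onSnd (m y) (θ x)) + onSnd (m y) (θ x))
      - (onSnd (c x) (D y) + onFst (c x) (D y)) - D (m (P x) y) = 0
  compat₃ : ∀ x y,
    (onFst (m x) (θ y) - onSnd (m x) (θ y))
      + (onFst (c y) (D x) - onSnd (bracket c y) (D x))
      - D (bracket c x y) + D (m x (P y)) = 0
  compat₄ : ∀ x y,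
    onSnd (c.flip y) (D x) + onFst (m x) (cobracket θ y) - onSnd (c x) (D y)
      + tau (onSnd (m y) (θ x)) - cobracket θ (m x y) + onSnd Q (D (m x y)) = 0

/-! ## Coboundary structures -/

/-- `Δ_r(x) = (id ⊗ L(x) - L(x) ⊗ id) r` for the product `m`. -/
noncomputable def coboundaryΔ (m : A →ₗ[K] A →ₗ[K] A) (r : A ⊗[K] A) : A →ₗ[K] A ⊗[K] A :=
  (LinearMap.lTensorHom A ∘ₗ m - LinearMap.rTensorHom A ∘ₗ m).flip r

/-- `θ_r(x) = (L(x) ⊗ id - id ⊗ ad(x)) r` for the operation `c`. -/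
noncomputable def coboundaryθ (c : A →ₗ[K] A →ₗ[K] A) (r : A ⊗[K] A) : A →ₗ[K] A ⊗[K] A :=
  (LinearMap.rTensorHom A ∘ₗ c - LinearMap.lTensorHom A ∘ₗ bracket c).flip r

@[simp] theorem coboundaryΔ_apply (m : A →ₗ[K] A →ₗ[K] A) (r : A ⊗[K] A) (x : A) :
    coboundaryΔ m r x = onSnd (m x) r - onFst (m x) r := rfl

@[simp] theorem coboundaryθ_apply (c : A →ₗ[K] A →ₗ[K] A) (r : A ⊗[K] A) (x : A) :
    coboundaryθ c r x = onFst (c x) r - onSnd (bracket c x) r := rfl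

/-- A relative PCA bialgebra is coboundary if `Δ = Δ_r` and `θ = θ_r` for some `r ∈ A ⊗ A`. -/
structure IsCoboundaryRelPCABialgebra (m c : A →ₗ[K] A →ₗ[K] A) (D θ : A →ₗ[K] A ⊗[K] A)
    (P Q : A →ₗ[K] A) : Prop where
  bialgebra : IsRelPCABialgebra m c D θ P Q
  coboundary : ∃ r : A ⊗[K] A, D = coboundaryΔ m r ∧ θ = coboundaryθ c r

/-! ## The Yang-Baxter equation -/

/-- `r₁₂ * s₁₃`, that is `(a ⊗ b, a' ⊗ b') ↦ (a * a') ⊗ b ⊗ b'`. -/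
noncomputable def prod1213 (m : A →ₗ[K] A →ₗ[K] A) (r s : A ⊗[K] A) : A ⊗[K] (A ⊗[K] A) :=
  LinearMap.rTensor (A ⊗[K] A) (TensorProduct.lift m)
    (TensorProduct.tensorTensorTensorComm K A A A A (r ⊗ₜ s))

/-- `r₁₂ * s₂₃`, that is `(a ⊗ b, a' ⊗ b') ↦ a ⊗ (b * a') ⊗ b'`. -/
noncomputable def prod1223 (m : A →ₗ[K] A →ₗ[K] A) (r s : A ⊗[K] A) : A ⊗[K] (A ⊗[K] A) :=
  LinearMap.lTensor A
    (LinearMap.rTensor A (TensorProduct.lift m) ∘ₗ (TensorProduct.assoc K A A A).symm.toLinearMap)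
    (TensorProduct.assoc K A A (A ⊗[K] A) (r ⊗ₜ s))

/-- `s₂₃ * r₁₂`, that is `(a' ⊗ b', a ⊗ b) ↦ a ⊗ (a' * b) ⊗ b'`. -/
noncomputable def prod2312 (m : A →ₗ[K] A →ₗ[K] A) (s r : A ⊗[K] A) : A ⊗[K] (A ⊗[K] A) :=
  prod1223 m.flip r s

/-- `r₁₃ * s₂₃`, that is `(a ⊗ b, a' ⊗ b') ↦ a ⊗ a' ⊗ (b * b')`. -/
noncomputable def prod1323 (m : A →ₗ[K] A →ₗ[K] A) (r s : A ⊗[K] A) : A ⊗[K] (A ⊗[K] A) :=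
  TensorProduct.assoc K A A A (LinearMap.lTensor (A ⊗[K] A) (TensorProduct.lift m)
    (TensorProduct.tensorTensorTensorComm K A A A A (r ⊗ₜ s)))

theorem prod1213_sum {ι : Type*} (I : Finset ι) (m : A →ₗ[K] A →ₗ[K] A) (a b : ι → A) :
    prod1213 m (∑ i ∈ I, a i ⊗ₜ[K] b i) (∑ j ∈ I, a j ⊗ₜ[K] b j)
      = ∑ i ∈ I, ∑ j ∈ I, m (a i) (a j) ⊗ₜ[K] (b i ⊗ₜ[K] b j) := by
  simp [prod1213, TensorProduct.sum_tmul, TensorProduct.tmul_sum, map_sum]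
  exact Finset.sum_comm

theorem prod1223_sum {ι : Type*} (I : Finset ι) (m : A →ₗ[K] A →ₗ[K] A) (a b : ι → A) :
    prod1223 m (∑ i ∈ I, a i ⊗ₜ[K] b i) (∑ j ∈ I, a j ⊗ₜ[K] b j)
      = ∑ i ∈ I, ∑ j ∈ I, a i ⊗ₜ[K] (m (b i) (a j) ⊗ₜ[K] b j) := by
  simp [prod1223, TensorProduct.sum_tmul, TensorProduct.tmul_sum, map_sum]
  exact Finset.sum_comm

theorem prod2312_sum {ι : Type*} (I : Finset ι) (m : A →ₗ[K] A →ₗ[K] A) (a b : ι → A) :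
    prod2312 m (∑ i ∈ I, a i ⊗ₜ[K] b i) (∑ j ∈ I, a j ⊗ₜ[K] b j)
      = ∑ i ∈ I, ∑ j ∈ I, a i ⊗ₜ[K] (m (a j) (b i) ⊗ₜ[K] b j) := by
  simp [prod2312, prod1223_sum]

theorem prod1323_sum {ι : Type*} (I : Finset ι) (m : A →ₗ[K] A →ₗ[K] A) (a b : ι → A) :
    prod1323 m (∑ i ∈ I, a i ⊗ₜ[K] b i) (∑ j ∈ I, a j ⊗ₜ[K] b j)
      = ∑ i ∈ I, ∑ j ∈ I, a i ⊗ₜ[K] (a j ⊗ₜ[K] m (b i) (b j)) := by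
  simp [prod1323, TensorProduct.sum_tmul, TensorProduct.tmul_sum, map_sum]
  exact Finset.sum_comm

/-- `A(r) = r₁₂ · r₁₃ - r₂₃ · r₁₂ + r₁₃ · r₂₃`. -/
noncomputable def aybe (m : A →ₗ[K] A →ₗ[K] A) (r : A ⊗[K] A) : A ⊗[K] (A ⊗[K] A) :=
  prod1213 m r r - prod2312 m r r + prod1323 m r r

/-- `T(r) = r₁₂ ∘ r₁₃ + r₁₂ ∘ r₂₃ - [r₁₃, r₂₃]`. -/
noncomputable def aplybe (c : A →ₗ[K] A →ₗ[K] A) (r : A ⊗[K] A) : A ⊗[K] (A ⊗[K] A) :=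
  prod1213 c r r + prod1223 c r r - prod1323 (bracket c) r r

/-- `r` is a solution of the relative PCA Yang-Baxter equation in `(A, m, c, P, Q)`. -/
structure IsRPCAYBESolution (m c : A →ₗ[K] A →ₗ[K] A) (P Q : A →ₗ[K] A) (r : A ⊗[K] A) :
    Prop where
  aybe_eq_zero : aybe m r = 0
  aplybe_eq_zero : aplybe c r = 0
  Q_P : onFst Q r - onSnd P r = 0
  P_Q : onFst P r - onSnd Q r = 0

/-- `r` is antisymmetric: `r = -τ(r)`. -/
def IsAntisymmetric (r : A ⊗[K] A) : Prop := r = -tau r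

end RelPCA

/-! The tensor `r` is read as the linear map `R : A* → A`, `R f = contract f r`, and everything is
tested against functionals, which separate tensors over a field in any dimension. Antisymmetry says
`g (R f) = -f (R g)`. The maps `Δ_r` and `θ_r` induce products on `A*`, namely `f * g = (f ⊗ g) Δ_r`
and `f ⋆ g = (f ⊗ g) θ_r`. The equation `A(r) = 0` gives `R (f * g) = R f · R g`, `T(r) = 0` gives
`R (f ⋆ g) = R f ∘ R g`, and the two linear conditions give `R (f ∘ Q) = P (R f)` and `R (f ∘ P) = Q
(R f)`: these are `contract_pair_coboundaryΔ`, `contract_pair_coboundaryθ`, `contract_comp_Q` and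
`contract_comp_P`.

Paired with functionals `f, g, k`, a coalgebra axiom at `x` therefore becomes `f(…) + g(…) + k(…) =
0`, where each argument is an expression in `x, R f, R g, R k` that vanishes by the axioms of the
algebra. No bidual and no finiteness enters.

The compatibility conditions are linear in `r`. Terms acting on both legs cancel, sometimes through
`τ r = -r`, or are moved by the `P`, `Q` conditions; what remains on each leg is again an algebra
axiom. -/

namespace RelPCA

variable {K A : Type*} [Field K] [AddCommGroup A] [Module K A]

/-! ## Contraction of tensors against functionals -/

section Contraction

variable {V W : Type*} [AddCommGroup V] [Module K V] [AddCommGroup W] [Module K W]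

/-- Contraction of the first tensor factor: `v ⊗ w ↦ f v • w`. -/
noncomputable def contract (f : V →ₗ[K] K) : V ⊗[K] W →ₗ[K] W :=
  (TensorProduct.lid K W).toLinearMap ∘ₗ LinearMap.rTensor W f

@[simp] theorem contract_tmul (f : V →ₗ[K] K) (v : V) (w : W) :
    contract f (v ⊗ₜ[K] w) = f v • w := rfl

/-- Tensors over a field are separated by products of functionals. -/
theorem eq_of_forall_contract {s t : V ⊗[K] W}
    (h : ∀ f : V →ₗ[K] K, contract f s = contract f t) : s = t := by
  let b := Module.Basis.ofVectorSpace K V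
  let e := Module.Basis.ofVectorSpace K W
  refine (b.tensorProduct e).ext_elem fun ⟨i, j⟩ => ?_
  have key : ∀ u : V ⊗[K] W,
      (b.tensorProduct e).repr u (i, j) = e.repr (contract (b.coord i) u) j := by
    intro u
    induction u with
    | zero => simp
    | tmul v w => simp [mul_comm]
    | add u v hu hv => simp [hu, hv]
  rw [key, key, h]

end Contraction

/-- The value of `f ⊗ g` on a tensor. -/
noncomputable def pair (f g : A →ₗ[K] K) : A ⊗[K] A →ₗ[K] K := g ∘ₗ contract f

/-- The value of `f ⊗ g ⊗ h` on a tensor. -/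
noncomputable def pair₃ (f g h : A →ₗ[K] K) : A ⊗[K] (A ⊗[K] A) →ₗ[K] K :=
  pair g h ∘ₗ contract f

theorem pair_apply (f g : A →ₗ[K] K) (t : A ⊗[K] A) : pair f g t = g (contract f t) := rfl

theorem pair₃_apply (f g h : A →ₗ[K] K) (t : A ⊗[K] (A ⊗[K] A)) :
    pair₃ f g h t = h (contract g (contract f t)) := rfl

theorem eq_of_forall_pair {s t : A ⊗[K] A} (h : ∀ f g, pair f g s = pair f g t) : s = t :=
  eq_of_forall_contract fun f => by
    rw [← sub_eq_zero, ← Module.forall_dual_apply_eq_zero_iff K]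
    intro g
    simpa [pair_apply, sub_eq_zero] using h f g

theorem eq_of_forall_pair₃ {s t : A ⊗[K] (A ⊗[K] A)}
    (H : ∀ f g h, pair₃ f g h s = pair₃ f g h t) : s = t :=
  eq_of_forall_contract fun f => eq_of_forall_pair fun g h => H f g h

/-! ### Transposing the tensor operations onto functionals -/

theorem pair_tau (f g : A →ₗ[K] K) (t : A ⊗[K] A) : pair f g (tau t) = pair g f t := by
  induction t with
  | zero => simp
  | tmul x y => simp [pair_apply, mul_comm]
  | add s t hs ht => simp [hs, ht]

theorem pair₃_idTensor (f g h : A →ₗ[K] K) (D : A →ₗ[K] A ⊗[K] A) (t : A ⊗[K] A) :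
    pair₃ f g h (idTensor D t) = pair f (pair g h ∘ₗ D) t := by
  induction t with
  | zero => simp
  | tmul x y => simp [pair_apply, pair₃_apply]
  | add s t hs ht => simp [hs, ht]

theorem pair₃_assoc_tmul (f g h : A →ₗ[K] K) (s : A ⊗[K] A) (y : A) :
    pair₃ f g h (TensorProduct.assoc K A A A (s ⊗ₜ y)) = pair f g s * h y := by
  induction s with
  | zero => simp
  | tmul x y => simp [pair_apply, pair₃_apply, mul_assoc]
  | add s t hs ht => simp [hs, ht, TensorProduct.add_tmul, add_mul]

theorem pair₃_tensorId (f g h : A →ₗ[K] K) (D : A →ₗ[K] A ⊗[K] A) (t : A ⊗[K] A) :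
    pair₃ f g h (tensorId D t) = pair (pair f g ∘ₗ D) h t := by
  induction t with
  | zero => simp
  | tmul x y => simp [pair₃_assoc_tmul, pair_apply]
  | add s t hs ht => simp [hs, ht]

theorem pair₃_tauId (f g h : A →ₗ[K] K) (t : A ⊗[K] (A ⊗[K] A)) :
    pair₃ f g h (tauId t) = pair₃ g f h t := by
  induction t with
  | zero => simp
  | tmul x t =>
    induction t with
    | zero => simp
    | tmul y z => simp [pair₃_apply, mul_left_comm]
    | add s t hs ht => simp [hs, ht, TensorProduct.tmul_add]
  | add s t hs ht => simp [hs, ht]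

theorem pair₃_xi (f g h : A →ₗ[K] K) (t : A ⊗[K] (A ⊗[K] A)) :
    pair₃ f g h (xi t) = pair₃ h f g t := by
  induction t with
  | zero => simp
  | tmul x t =>
    induction t with
    | zero => simp
    | tmul y z => simp [pair₃_apply]; ring
    | add s t hs ht => simp [hs, ht, TensorProduct.tmul_add]
  | add s t hs ht => simp [hs, ht]

theorem pair₃_rTensor (f g h : A →ₗ[K] K) (Q : A →ₗ[K] A) (t : A ⊗[K] (A ⊗[K] A)) :
    pair₃ f g h (LinearMap.rTensor (A ⊗[K] A) Q t) = pair₃ (f ∘ₗ Q) g h t := by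
  induction t with
  | zero => simp
  | tmul x t => simp [pair₃_apply]
  | add s t hs ht => simp [hs, ht]

theorem pair₃_lTensor_rTensor (f g h : A →ₗ[K] K) (Q : A →ₗ[K] A) (t : A ⊗[K] (A ⊗[K] A)) :
    pair₃ f g h (LinearMap.lTensor A (LinearMap.rTensor A Q) t) = pair₃ f (g ∘ₗ Q) h t := by
  -- Swapping the first two slots reduces to the first-slot case; what is left is that `τ ⊗ id`
  -- intertwines the two actions of `Q`.
  rw [← pair₃_tauId g f h, ← pair₃_tauId (g ∘ₗ Q) f h, ← pair₃_rTensor]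
  congr 1
  induction t with
  | zero => simp
  | tmul x t =>
    induction t with
    | zero => simp
    | tmul y z => simp
    | add s t hs ht => simp only [hs, ht, TensorProduct.tmul_add, map_add]
  | add s t hs ht => simp only [hs, ht, map_add]

theorem pair_onFst (f g : A →ₗ[K] K) (p : A →ₗ[K] A) (t : A ⊗[K] A) :
    pair f g (onFst p t) = pair (f ∘ₗ p) g t := by
  induction t with
  | zero => simp
  | tmul x y => simp [pair_apply]
  | add s t hs ht => simp [hs, ht]

theorem pair_onSnd (f g : A →ₗ[K] K) (q : A →ₗ[K] A) (t : A ⊗[K] A) :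
    pair f g (onSnd q t) = pair f (g ∘ₗ q) t := by
  induction t with
  | zero => simp
  | tmul x y => simp [pair_apply]
  | add s t hs ht => simp [hs, ht]

theorem pair₃_prod1213 (f g h : A →ₗ[K] K) (m : A →ₗ[K] A →ₗ[K] A) (r s : A ⊗[K] A) :
    pair₃ f g h (prod1213 m r s) = f (m (contract g (tau r)) (contract h (tau s))) := by
  unfold prod1213
  induction r with
  | zero => simp
  | tmul a b =>
    induction s with
    | zero => simp
    | tmul a' b' => simp [pair₃_apply]; ring
    | add s t hs ht => simp [hs, ht, TensorProduct.tmul_add]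
  | add s t hs ht => simp [hs, ht, TensorProduct.add_tmul]

theorem pair₃_prod1223 (f g h : A →ₗ[K] K) (m : A →ₗ[K] A →ₗ[K] A) (r s : A ⊗[K] A) :
    pair₃ f g h (prod1223 m r s) = g (m (contract f r) (contract h (tau s))) := by
  unfold prod1223
  induction r with
  | zero => simp
  | tmul a b =>
    induction s with
    | zero => simp
    | tmul a' b' => simp [pair₃_apply]; ring
    | add s t hs ht => simp only [hs, ht, TensorProduct.tmul_add, map_add]
  | add s t hs ht => simp only [hs, ht, TensorProduct.add_tmul, map_add, LinearMap.add_apply]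

theorem pair₃_prod1323 (f g h : A →ₗ[K] K) (m : A →ₗ[K] A →ₗ[K] A) (r s : A ⊗[K] A) :
    pair₃ f g h (prod1323 m r s) = h (m (contract f r) (contract g s)) := by
  unfold prod1323
  induction r with
  | zero => simp
  | tmul a b =>
    induction s with
    | zero => simp
    | tmul a' b' => simp [pair₃_apply]; ring
    | add s t hs ht => simp only [hs, ht, TensorProduct.tmul_add, map_add]
  | add s t hs ht => simp only [hs, ht, TensorProduct.add_tmul, map_add, LinearMap.add_apply]

/-! ## Antisymmetric tensors -/

section Antisymmetric

variable {m c : A →ₗ[K] A →ₗ[K] A} {P Q : A →ₗ[K] A} {r : A ⊗[K] A}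

theorem IsAntisymmetric.tau_eq (hr : IsAntisymmetric r) : tau r = -r := by
  rw [eq_comm, neg_eq_iff_eq_neg]; exact hr

theorem IsAntisymmetric.pair_swap (hr : IsAntisymmetric r) (f g : A →ₗ[K] K) :
    pair f g r = -f (contract g r) := by
  rw [← pair_apply, ← pair_tau, hr.tau_eq, map_neg]

/-- Antisymmetry turns the minus sign of `Δ_r` into a plus, which makes the dual product visibly
commutative. -/
theorem IsAntisymmetric.pair_coboundaryΔ (hr : IsAntisymmetric r) (f g : A →ₗ[K] K) (x : A) :
    pair f g (coboundaryΔ m r x) = g (m x (contract f r)) + f (m x (contract g r)) := by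
  rw [coboundaryΔ_apply, map_sub, pair_onFst, pair_onSnd, hr.pair_swap (f ∘ₗ m x), pair_apply]
  simp

theorem IsAntisymmetric.pair_coboundaryθ (hr : IsAntisymmetric r) (f g : A →ₗ[K] K) (x : A) :
    pair f g (coboundaryθ c r x)
      = -f (c x (contract g r)) - g (c x (contract f r)) + g (c (contract f r) x) := by
  rw [coboundaryθ_apply, map_sub, pair_onFst, pair_onSnd, hr.pair_swap (f ∘ₗ c x), pair_apply]
  simp; ring

/-- On functionals, contraction with a solution `r` is multiplicative for the product
dual to `Δ_r`. -/
theorem contract_pair_coboundaryΔ (hr : IsAntisymmetric r) (hm : IsCommAssoc m)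
    (h : aybe m r = 0) (f g : A →ₗ[K] K) :
    contract (pair f g ∘ₗ coboundaryΔ m r) r = m (contract f r) (contract g r) := by
  rw [← sub_eq_zero, ← Module.forall_dual_apply_eq_zero_iff K]
  intro k
  -- The test functional `k` takes the third slot, where `A(r)` carries the product `R f · R g`; the
  -- other two terms are those of `(f * g) (R k)`.
  have e := congrArg (pair₃ f g k) h
  simp only [aybe, prod2312, map_add, map_sub, map_neg, map_zero, pair₃_prod1213, pair₃_prod1223,
    pair₃_prod1323, hr.tau_eq, LinearMap.neg_apply, LinearMap.flip_apply, neg_neg] at e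
  have s := hr.pair_swap (pair f g ∘ₗ coboundaryΔ m r) k
  rw [pair_apply, LinearMap.comp_apply, hr.pair_coboundaryΔ, hm.comm _ (contract f r),
    hm.comm _ (contract g r)] at s
  rw [hm.comm (contract k r) (contract f r)] at e
  rw [map_sub, s]
  linear_combination -e

/-- On functionals, contraction with a solution `r` is multiplicative for the operation
dual to `θ_r`. -/
theorem contract_pair_coboundaryθ (hr : IsAntisymmetric r) (h : aplybe c r = 0)
    (f g : A →ₗ[K] K) :
    contract (pair f g ∘ₗ coboundaryθ c r) r = c (contract f r) (contract g r) := by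
  rw [← sub_eq_zero, ← Module.forall_dual_apply_eq_zero_iff K]
  intro k
  -- Here `k` takes the first slot, since that is where `T(r)` carries `R f ∘ R g`.
  have e := congrArg (pair₃ k f g) h
  simp only [aplybe, map_add, map_sub, map_neg, map_zero, pair₃_prod1213, pair₃_prod1223,
    pair₃_prod1323, hr.tau_eq, LinearMap.neg_apply, neg_neg, bracket_apply] at e
  have s := hr.pair_swap (pair f g ∘ₗ coboundaryθ c r) k
  rw [pair_apply, LinearMap.comp_apply, hr.pair_coboundaryθ] at s
  rw [map_sub, s]
  linear_combination -e

end Antisymmetric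

/-! ### Coalgebra axioms for `Δ_r` and `θ_r` -/

section Coboundary

variable {m c : A →ₗ[K] A →ₗ[K] A} {P Q : A →ₗ[K] A} {r : A ⊗[K] A}

theorem IsCommAssoc.left_comm (hm : IsCommAssoc m) (x y z : A) :
    m x (m y z) = m y (m x z) := by
  rw [← hm.assoc, hm.comm x y, hm.assoc]

theorem pair_cobracket (f g : A →ₗ[K] K) (θ : A →ₗ[K] A ⊗[K] A) (x : A) :
    pair f g (cobracket θ x) = pair f g (θ x) - pair g f (θ x) := by
  rw [cobracket_apply, map_sub, pair_tau]

theorem pair_comp_cobracket (f g : A →ₗ[K] K) (θ : A →ₗ[K] A ⊗[K] A) :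
    pair f g ∘ₗ cobracket θ = pair f g ∘ₗ θ - pair g f ∘ₗ θ := by
  ext x; simp [pair_tau]

theorem contract_sub_left (f g : A →ₗ[K] K) (t : A ⊗[K] A) :
    contract (f - g) t = contract f t - contract g t := by
  simp [contract, LinearMap.rTensor_sub]

theorem contract_comp (f : A →ₗ[K] K) (p : A →ₗ[K] A) (t : A ⊗[K] A) :
    contract (f ∘ₗ p) t = contract f (onFst p t) := by
  simp [contract, onFst, LinearMap.rTensor_comp]

theorem contract_onSnd (f : A →ₗ[K] K) (q : A →ₗ[K] A) (t : A ⊗[K] A) :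
    contract f (onSnd q t) = q (contract f t) := by
  induction t with
  | zero => simp
  | tmul x y => simp
  | add s t hs ht => simp only [hs, ht, map_add]

theorem IsRPCAYBESolution.contract_comp_Q (h : IsRPCAYBESolution m c P Q r) (f : A →ₗ[K] K) :
    contract (f ∘ₗ Q) r = P (contract f r) := by
  rw [contract_comp, sub_eq_zero.1 h.Q_P, contract_onSnd]

theorem IsRPCAYBESolution.contract_comp_P (h : IsRPCAYBESolution m c P Q r) (f : A →ₗ[K] K) :
    contract (f ∘ₗ P) r = Q (contract f r) := by
  rw [contract_comp, sub_eq_zero.1 h.P_Q, contract_onSnd]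

theorem isCocommCoassoc_coboundaryΔ (hm : IsCommAssoc m) (hr : IsAntisymmetric r)
    (h : aybe m r = 0) : IsCocommCoassoc (coboundaryΔ m r) where
  cocomm x := by
    refine eq_of_forall_pair fun f g => ?_
    rw [pair_tau, hr.pair_coboundaryΔ, hr.pair_coboundaryΔ, add_comm]
  coassoc x := by
    refine eq_of_forall_pair₃ fun f g k => ?_
    -- With `u, v, w` the images of `f, g, k` under `R`, both sides equal `f (x·v·w) + g (x·u·w) + k
    -- (x·u·v)`.
    simp only [pair₃_idTensor, pair₃_tensorId, hr.pair_coboundaryΔ, LinearMap.comp_apply,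
      contract_pair_coboundaryΔ hr hm h, hm.assoc, hm.comm]
    ring

theorem isAntiPreLieCoalgebra_coboundaryθ (hc : IsAntiPreLie c) (hr : IsAntisymmetric r)
    (h : aplybe c r = 0) : IsAntiPreLieCoalgebra (coboundaryθ c r) where
  left_comm x := by
    refine eq_of_forall_pair₃ fun f g k => ?_
    set u := contract f r with hu
    set v := contract g r with hv
    set w := contract k r with hw
    have e₁ := congrArg f (hc.left_comm v x w)
    have e₂ := congrArg g (hc.left_comm u x w)
    have e₃ := congrArg k (hc.left_comm u v x)
    have e₄ := congrArg k (hc.left_comm u x v)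
    have e₅ := congrArg k (hc.left_comm v x u)
    have e₆ := congrArg k (hc.cyclic u v x)
    simp only [map_sub, map_add, map_zero, pair₃_tauId, pair₃_idTensor, pair₃_tensorId,
      hr.pair_coboundaryθ, LinearMap.comp_apply, contract_pair_coboundaryθ hr h, bracket_apply,
      LinearMap.sub_apply, ← hu, ← hv, ← hw] at e₁ e₂ e₃ e₄ e₅ e₆ ⊢
    -- The `k` part is the Jacobi identity for the commutator of `u, v, x`. Expanding it by
    -- `left_comm` makes the two halves of each bracket agree, so it is twice the cyclic sum.
    linear_combination e₁ - e₂ - e₃ + e₄ - e₅ + 2 * e₆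
  cyclic x := by
    refine eq_of_forall_pair₃ fun f g k => ?_
    set u := contract f r with hu
    set v := contract g r with hv
    set w := contract k r with hw
    have e₁ := congrArg f (hc.left_comm v x w)
    have e₂ := congrArg f (hc.left_comm w x v)
    have e₃ := congrArg f (hc.cyclic v w x)
    have e₄ := congrArg g (hc.left_comm u x w)
    have e₅ := congrArg g (hc.left_comm w x u)
    have e₆ := congrArg g (hc.cyclic u w x)
    have e₇ := congrArg k (hc.left_comm u x v)
    have e₈ := congrArg k (hc.left_comm v x u)
    have e₉ := congrArg k (hc.cyclic u v x)
    simp only [map_sub, map_add, map_zero, pair₃_tauId, pair₃_tensorId, pair₃_xi,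
      LinearMap.add_apply, LinearMap.id_apply,
      hr.pair_coboundaryθ, LinearMap.comp_apply, contract_pair_coboundaryθ hr h, bracket_apply,
      LinearMap.sub_apply, ← hu, ← hv, ← hw] at e₁ e₂ e₃ e₄ e₅ e₆ e₇ e₈ e₉ ⊢
    linear_combination -e₁ + e₂ - e₃ + e₄ - e₅ + e₆ - e₇ + e₈ - e₉

theorem IsRelPCAAlgebra.Q_mul (hA : IsRelPCAAlgebra m c P Q) (x y : A) :
    Q (m x y) = m x (Q y) - m (P x) y :=
  (sub_eq_zero.1 (hA.mul_Q x y)).symm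

/-- Each axiom is dual to a mixture of algebra axioms, one for each functional: `coleibniz` splits
into one `circ_mul` and two `mul_circ`, `D_θ` into `mul_circ`, `circ_mul` and Leibniz, `θ_D` into
two `mul_circ` and Leibniz. The axioms for `P` pair a `Q` identity on the first leg with a
derivation on the second. -/
theorem isRelPCACoalgebra_coboundary (hA : IsRelPCAAlgebra m c P Q) (hr : IsAntisymmetric r)
    (h : IsRPCAYBESolution m c P Q r) :
    IsRelPCACoalgebra (coboundaryΔ m r) (coboundaryθ c r) Q P where
  cocommCoassoc := isCocommCoassoc_coboundaryΔ hA.commAssoc hr h.aybe_eq_zero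
  antiPreLieCoalgebra := isAntiPreLieCoalgebra_coboundaryθ hA.antiPreLie hr h.aplybe_eq_zero
  D_Q x := by
    refine eq_of_forall_pair fun f g => ?_
    have e₁ := congrArg f (hA.mul_Q (contract g r) x)
    have e₂ := congrArg g (hA.mul_Q (contract f r) x)
    simp only [map_sub, map_add, map_zero, pair_onFst, pair_onSnd, hr.pair_coboundaryΔ,
      h.contract_comp_Q, LinearMap.comp_apply, hA.commAssoc.comm] at e₁ e₂ ⊢
    linear_combination e₁ + e₂
  cobracket_Q x := by
    refine eq_of_forall_pair fun f g => ?_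
    have e₁ := congrArg f (hA.circ_Q (contract g r) x)
    have e₂ := congrArg g (hA.circ_Q (contract f r) x)
    simp only [map_sub, map_add, map_zero, pair_onFst, pair_onSnd, pair_cobracket,
      hr.pair_coboundaryθ, h.contract_comp_Q, LinearMap.comp_apply] at e₁ e₂ ⊢
    linear_combination e₂ - e₁
  coleibniz x := by
    refine eq_of_forall_pair₃ fun f g k => ?_
    set u := contract f r with hu
    set v := contract g r with hv
    set w := contract k r with hw
    have hm := hA.commAssoc
    have e₁ := congrArg f (hA.circ_mul v w x)
    have e₂ := congrArg g (hA.mul_circ w u x)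
    have e₃ := congrArg k (hA.mul_circ v u x)
    simp only [map_sub, map_add, map_zero, pair₃_tauId, pair₃_idTensor, pair₃_tensorId,
      pair₃_rTensor, pair_cobracket, pair_comp_cobracket, contract_sub_left, hr.pair_coboundaryΔ, hr.pair_coboundaryθ, LinearMap.comp_apply,
      contract_pair_coboundaryΔ hr hm h.aybe_eq_zero, contract_pair_coboundaryθ hr h.aplybe_eq_zero,
      h.contract_comp_Q, bracket_apply, LinearMap.sub_apply, ← hu, ← hv, ← hw,
      hA.Q_mul, hm.assoc, hm.comm, hm.left_comm] at e₁ e₂ e₃ ⊢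
    linear_combination -e₁ + e₂ + e₃
  D_P x := by
    refine eq_of_forall_pair fun f g => ?_
    have e₁ := congrArg f (hA.mul_Q x (contract g r))
    have e₂ := congrArg g (hA.relPoisson.deriv_mul (contract f r) x)
    simp only [map_sub, map_add, map_zero, pair_onFst, pair_onSnd, hr.pair_coboundaryΔ,
      h.contract_comp_Q, h.contract_comp_P, LinearMap.comp_apply, hA.commAssoc.comm] at e₁ e₂ ⊢
    linear_combination -e₁ - e₂
  θ_P x := by
    refine eq_of_forall_pair fun f g => ?_
    have e₁ := congrArg f (hA.circ_Q x (contract g r))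
    have e₂ := congrArg g (hA.relPoisson.deriv_bracket (contract f r) x)
    simp only [map_sub, map_add, map_zero, pair_onFst, pair_onSnd, hr.pair_coboundaryθ,
      h.contract_comp_Q, h.contract_comp_P, LinearMap.comp_apply, bracket_apply] at e₁ e₂ ⊢
    linear_combination e₁ - e₂
  D_θ x := by
    refine eq_of_forall_pair₃ fun f g k => ?_
    set u := contract f r with hu
    set v := contract g r with hv
    set w := contract k r with hw
    have hm := hA.commAssoc
    have e₁ := congrArg f (hA.mul_circ x v w)
    have e₂ := congrArg g (hA.circ_mul u x w)
    have e₃ := congrArg k (hA.relPoisson.leibniz u x v)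
    simp only [map_sub, map_add, map_zero, pair₃_tauId, pair₃_idTensor, pair₃_tensorId,
      pair₃_lTensor_rTensor, pair_comp_cobracket, contract_sub_left, hr.pair_coboundaryΔ, hr.pair_coboundaryθ, LinearMap.comp_apply,
      contract_pair_coboundaryΔ hr hm h.aybe_eq_zero, contract_pair_coboundaryθ hr h.aplybe_eq_zero,
      h.contract_comp_Q, bracket_apply, LinearMap.sub_apply, ← hu, ← hv, ← hw,
      hA.Q_mul, hm.assoc, hm.comm] at e₁ e₂ e₃ ⊢
    linear_combination e₁ - e₂ + e₃
  θ_D x := by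
    refine eq_of_forall_pair₃ fun f g k => ?_
    set u := contract f r with hu
    set v := contract g r with hv
    set w := contract k r with hw
    have hm := hA.commAssoc
    have e₁ := congrArg f (hA.mul_circ v x w)
    have e₂ := congrArg g (hA.mul_circ u x w)
    have e₃ := congrArg k (hA.relPoisson.leibniz u v x)
    simp only [map_sub, map_add, map_zero, pair₃_tauId, pair₃_idTensor, pair₃_tensorId,
      hr.pair_coboundaryΔ, hr.pair_coboundaryθ, LinearMap.comp_apply,
      contract_pair_coboundaryΔ hr hm h.aybe_eq_zero, bracket_apply, LinearMap.sub_apply, ← hu, ← hv, ← hw,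
      hm.assoc, hm.comm, hm.left_comm] at e₁ e₂ e₃ ⊢
    linear_combination -e₁ - e₂ - e₃

end Coboundary

/-! ### Compatibility conditions, linear in `r` -/

section Bialgebra

variable {m c : A →ₗ[K] A →ₗ[K] A} {P Q : A →ₗ[K] A} {r : A ⊗[K] A}

theorem bracket_eq_sub (c : A →ₗ[K] A →ₗ[K] A) (x : A) : bracket c x = c x - c.flip x := rfl

theorem onSnd_sub_left (p q : A →ₗ[K] A) (t : A ⊗[K] A) :
    onSnd (p - q) t = onSnd p t - onSnd q t := by
  simp [onSnd, LinearMap.lTensor_sub]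

theorem tau_onFst (p : A →ₗ[K] A) (t : A ⊗[K] A) : tau (onFst p t) = onSnd p (tau t) := by
  induction t with
  | zero => simp
  | tmul x y => simp
  | add s t hs ht => simp only [hs, ht, map_add]

theorem tau_onSnd (p : A →ₗ[K] A) (t : A ⊗[K] A) : tau (onSnd p t) = onFst p (tau t) := by
  induction t with
  | zero => simp
  | tmul x y => simp
  | add s t hs ht => simp only [hs, ht, map_add]

/-- Fixes a normal form for operators on both legs, so that such terms cancel syntactically. -/
theorem onFst_onSnd (p q : A →ₗ[K] A) (t : A ⊗[K] A) :
    onFst p (onSnd q t) = onSnd q (onFst p t) := by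
  induction t with
  | zero => simp
  | tmul x y => simp
  | add s t hs ht => simp only [hs, ht, map_add]

theorem IsAntisymmetric.pair_onFst_eq (hr : IsAntisymmetric r) (f g : A →ₗ[K] K)
    (p : A →ₗ[K] A) : pair f g (onFst p r) = -f (p (contract g r)) := by
  rw [pair_onFst, hr.pair_swap]; rfl

theorem IsAntisymmetric.pair_onFst_onFst (hr : IsAntisymmetric r) (f g : A →ₗ[K] K)
    (p q : A →ₗ[K] A) : pair f g (onFst p (onFst q r)) = -f (p (q (contract g r))) := by
  rw [pair_onFst, pair_onFst, hr.pair_swap]; rfl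

theorem pair_onSnd_eq (f g : A →ₗ[K] K) (q : A →ₗ[K] A) (t : A ⊗[K] A) :
    pair f g (onSnd q t) = g (q (contract f t)) := by
  rw [pair_onSnd]; rfl

theorem isASIBialgebra_coboundaryΔ (hm : IsCommAssoc m) (hr : IsAntisymmetric r)
    (h : aybe m r = 0) : IsASIBialgebra m (coboundaryΔ m r) where
  commAssoc := hm
  cocommCoassoc := isCocommCoassoc_coboundaryΔ hm hr h
  compat x y := by
    refine eq_of_forall_pair fun f g => ?_
    simp only [coboundaryΔ_apply, map_sub, map_add, onFst_onSnd, hr.pair_onFst_eq,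
      hr.pair_onFst_onFst, pair_onSnd_eq, contract_onSnd,
      hm.assoc, hm.left_comm]
    ring

theorem isAntiPreLieBialgebra_coboundaryθ (hc : IsAntiPreLie c) (hr : IsAntisymmetric r)
    (h : aplybe c r = 0) : IsAntiPreLieBialgebra c (coboundaryθ c r) where
  antiPreLie := hc
  antiPreLieCoalgebra := isAntiPreLieCoalgebra_coboundaryθ hc hr h
  compat₁ x y := by
    refine eq_of_forall_pair fun f g => ?_
    have e₁ := congrArg f (hc.left_comm (contract g r) x y)
    have e₂ := congrArg g (hc.left_comm (contract f r) x y)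
    simp only [coboundaryθ_apply, LinearMap.sub_apply, LinearMap.id_apply, bracket_eq_sub,
      onSnd_sub_left, map_sub, map_add, map_neg, map_zero, tau_onFst, tau_onSnd,
      hr.tau_eq, onFst_onSnd, hr.pair_onFst_eq, hr.pair_onFst_onFst, pair_onSnd_eq,
      contract_onSnd, LinearMap.flip_apply] at e₁ e₂ ⊢
    -- The two-leg terms `(L(x) ⊗ L(y) - L(y) ⊗ L(x)) r` are `τ`-invariant because `τ r = -r`, so
    -- `id - τ` kills them.
    linear_combination e₂ - e₁
  compat₂ x y := by
    refine eq_of_forall_pair fun f g => ?_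
    set u := contract f r with hu
    have e₁ := congrArg f (hc.left_comm x y (contract g r))
    have e₂ := congrArg g (hc.left_comm u x y)
    have e₃ := congrArg g (hc.left_comm u y x)
    have e₄ := congrArg g (hc.left_comm x y u)
    have e₅ := congrArg g (hc.cyclic u x y)
    simp only [coboundaryθ_apply, LinearMap.sub_apply, bracket_eq_sub,
      onSnd_sub_left, map_sub, map_add, map_zero,
      onFst_onSnd, hr.pair_onFst_eq, hr.pair_onFst_onFst, pair_onSnd_eq,
      contract_onSnd, LinearMap.flip_apply, ← hu] at e₁ e₂ e₃ e₄ e₅ ⊢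
    -- The `g` part is again the Jacobi identity, now for `u, x, y`, hence the factor 2.
    linear_combination -e₁ + e₂ - e₃ + e₄ - 2 * e₅

theorem isRelPCABialgebra_coboundary (hA : IsRelPCAAlgebra m c P Q) (hr : IsAntisymmetric r)
    (h : IsRPCAYBESolution m c P Q r) :
    IsRelPCABialgebra m c (coboundaryΔ m r) (coboundaryθ c r) P Q where
  algebra := hA
  coalgebra := isRelPCACoalgebra_coboundary hA hr h
  asi := isASIBialgebra_coboundaryΔ hA.commAssoc hr h.aybe_eq_zero
  antiPreLieBialgebra := isAntiPreLieBialgebra_coboundaryθ hA.antiPreLie hr h.aplybe_eq_zero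
  compat₁ x y := by
    refine eq_of_forall_pair fun f g => ?_
    have hm := hA.commAssoc
    have e₁ := congrArg f (hA.circ_mul x y (contract g r))
    have e₂ := congrArg g (hA.relPoisson.leibniz x y (contract f r))
    simp only [coboundaryΔ_apply, coboundaryθ_apply, LinearMap.sub_apply, bracket_eq_sub,
      onSnd_sub_left, map_sub, map_add, map_zero,
      onFst_onSnd, sub_eq_zero.1 h.Q_P, hr.pair_onFst_eq, hr.pair_onFst_onFst, pair_onSnd_eq,
      contract_onSnd, LinearMap.flip_apply,
      hm.assoc, hm.comm] at e₁ e₂ ⊢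
    linear_combination -e₁ + e₂
  compat₂ x y := by
    refine eq_of_forall_pair fun f g => ?_
    have hm := hA.commAssoc
    have e₁ := congrArg f (hA.mul_circ (contract g r) x y)
    have e₂ := congrArg g (hA.mul_circ (contract f r) x y)
    simp only [coboundaryΔ_apply, coboundaryθ_apply, LinearMap.sub_apply, bracket_eq_sub,
      onSnd_sub_left, map_sub, map_add, map_neg, map_zero, tau_onFst, tau_onSnd,
      hr.tau_eq, onFst_onSnd, hr.pair_onFst_eq, hr.pair_onFst_onFst, pair_onSnd_eq,
      contract_onSnd, LinearMap.flip_apply,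
      hm.assoc, hm.comm, hm.left_comm] at e₁ e₂ ⊢
    linear_combination e₁ + e₂
  compat₃ x y := by
    refine eq_of_forall_pair fun f g => ?_
    have hm := hA.commAssoc
    have e₁ := congrArg f (hA.mul_circ x y (contract g r))
    have e₂ := congrArg g (hA.relPoisson.leibniz (contract f r) x y)
    simp only [coboundaryΔ_apply, coboundaryθ_apply, LinearMap.sub_apply, bracket_eq_sub,
      onSnd_sub_left, map_sub, map_add, map_zero,
      onFst_onSnd, hr.pair_onFst_eq, hr.pair_onFst_onFst, pair_onSnd_eq,
      contract_onSnd, LinearMap.flip_apply,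
      hm.assoc, hm.comm] at e₁ e₂ ⊢
    linear_combination -e₁ - e₂
  compat₄ x y := by
    refine eq_of_forall_pair fun f g => ?_
    have hm := hA.commAssoc
    have e₁ := congrArg f (hA.mul_circ x (contract g r) y)
    have e₂ := congrArg g (hA.circ_mul (contract f r) x y)
    -- The one two-leg term that does not cancel: `id ⊗ Q` is traded for `P ⊗ id` on `r`, leaving an
    -- operator on the first leg only.
    have e₃ : g (Q (contract f (onFst (m (m x y)) r))) = -f (m (m x y) (P (contract g r))) := by
      rw [← pair_onSnd_eq, ← onFst_onSnd, ← sub_eq_zero.1 h.P_Q, hr.pair_onFst_onFst]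
    simp only [coboundaryΔ_apply, coboundaryθ_apply, cobracket_apply, LinearMap.sub_apply,
      bracket_eq_sub, onSnd_sub_left, map_sub, map_add, map_neg, map_zero,
      tau_onFst, tau_onSnd, hr.tau_eq, onFst_onSnd, hr.pair_onFst_eq, hr.pair_onFst_onFst,
      pair_onSnd_eq, contract_onSnd, LinearMap.flip_apply, hA.Q_mul,
      hm.assoc, hm.comm, hm.left_comm] at e₁ e₂ e₃ ⊢
    linear_combination -e₁ + e₂ - e₃

end Bialgebra

end RelPCA

theorem mainTheorem4 {K A : Type*} [Field K] [CharZero K] [AddCommGroup A] [Module K A]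
    (m c : A →ₗ[K] A →ₗ[K] A) (P Q : A →ₗ[K] A)
    (hA : RelPCA.IsRelPCAAlgebra m c P Q)
    (r : A ⊗[K] A) (hr : RelPCA.IsAntisymmetric r)
    (hsol : RelPCA.IsRPCAYBESolution m c P Q r) :
    RelPCA.IsCoboundaryRelPCABialgebra m c
      (RelPCA.coboundaryΔ m r) (RelPCA.coboundaryθ c r) P Q :=
  ⟨RelPCA.isRelPCABialgebra_coboundary hA hr hsol, r, rfl, rfl⟩
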